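/- For a real number $z\ge 0$ and an integer $n\ge 1$, let $P_z(n)=\prod_{p\le z,\ p\mid n}p$ be the product of the primes $p\le z$ dividing $n$. There is an absolute constant $C$ such that the following holds for all real numbers $z\ge 0$, $N\ge 1/2$ and $a$ (the condition $N\ge 1/2$ says that $(N,2N]$ contains an integer). If $n$ is chosen uniformly at random among the integers with $N<n\le 2N$, then the expected value of $$\sum_{\substack{d\mid n\\ a/P_z(n)<d\le 2a\\ p\mid d\,\Rightarrow\, p>z}}\ \ \sum_{\substack{d'\mid n,\ d'\text{ squarefree}\\ p\mid d'\,\Rightarrow\, z^{1/2}<p\le z}}1$$ is at most $C$. Here $d,d'$ run over positive divisors of $n$, and $p$ always denotes a prime. -/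

import Mathlib

open scoped BigOperators

noncomputable section

/-- `d` is `z`-rough: every prime divisor of `d` exceeds `z`. -/
def IsRough (z : ℝ) (d : ℕ) : Prop :=
  ∀ p : ℕ, p.Prime → p ∣ d → z < (p : ℝ)

/-- Every prime divisor of `d` lies in the interval `(z^{1/2}, z]`. -/
def PrimesInWindow (z : ℝ) (d : ℕ) : Prop :=
  ∀ p : ℕ, p.Prime → p ∣ d → Real.sqrt z < (p : ℝ) ∧ (p : ℝ) ≤ z

/-- `P_z(n)`, the product of the primes `p ≤ z` dividing `n` (used for `n ≥ 1`). -/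
def smoothRadical (z : ℝ) (n : ℕ) : ℕ :=
  ∏ p ∈ n.primeFactors with ((p : ℕ) : ℝ) ≤ z, p

open Classical in
/-- The double sum over pairs `(d, d')` of divisors of `n`: `d` is `z`-rough with
`a / P_z(n) < d ≤ 2a`, and `d'` is squarefree with all its prime factors in `(z^{1/2}, z]`. -/
def pairCount (z a : ℝ) (n : ℕ) : ℕ :=
  ∑ _d ∈ n.divisors.filter (fun d =>
      IsRough z d ∧ a / (smoothRadical z n : ℝ) < (d : ℝ) ∧ (d : ℝ) ≤ 2 * a),
    ∑ _d' ∈ n.divisors.filter (fun d' => Squarefree d' ∧ PrimesInWindow z d'), 1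

/-- The integers `n` with `N < n ≤ 2N`, for real `N ≥ 0`. -/
def dyadicRange (N : ℝ) : Finset ℕ :=
  Finset.Ioc ⌊N⌋₊ ⌊2 * N⌋₊

theorem mem_dyadicRange {N : ℝ} (hN : 0 ≤ N) (n : ℕ) :
    n ∈ dyadicRange N ↔ N < (n : ℝ) ∧ (n : ℝ) ≤ 2 * N := by
  rw [dyadicRange, Finset.mem_Ioc, Nat.floor_lt hN, Nat.le_floor_iff (by linarith)]

/-- The expected value of `pairCount z a n` for `n` uniform among the integers in `(N, 2N]`. -/
def expectedPairCount (z N a : ℝ) : ℝ :=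
  (∑ n ∈ dyadicRange N, (pairCount z a n : ℝ)) / ((dyadicRange N).card : ℝ)

end

/-!
Write `n = d m` with `d` rough. Since every prime factor of `d` exceeds `z`, both `P_z(n)` and the
number `f(n)` of admissible `d'` depend only on the cofactor: `P_z(n) = P_z(m)`, `f(n) = f(m)`.
Put `L = max 1 (log z)` and `Y = N / 2a`. The size conditions force `Y < m < 4 Y P_z(m)`.

For fixed `m`, the rough `d ≤ 2N / m` are counted by a sieve bound `card_roughUpTo_le`: at most
`O(X / L)` rough numbers lie below `X ≥ z`. It follows from Chebyshev's bound for `ψ` by comparing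
`∑ log n` over rough `n ≤ X` with the reciprocal sum of the rough numbers, which is `O(log X / L)`
because its product with `∑_{k ≤ z} 1 / k` is part of a harmonic sum up to `X ^ 2`. A rough `d > 1`
exceeds `z`, so `X = 2N / m ≥ z` holds automatically; the divisor `d = 1` is treated apart, by
bounding the average of `f`.

It remains to see that `∑ f(m) / m = O(L)` over `Y < m < 4 Y P_z(m)`, which is
`sum_card_windowDivisors_div_le`. With `ε = 1 / L`, Rankin's trick inserts `(4 Y P_z(m) / m) ^ ε`.
The function `f(m) P_z(m) ^ ε` is bounded on average, as its Euler product is controlled by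
`∑_{p ≤ z} log p / (p L) = O(1)`, and the tail of `∑ m ^ (-1 - ε)` beyond `Y` is `O(L Y ^ (-ε))`.
-/

/-! ### A Mertens-type estimate -/

open Finset in
/-- A Mertens-type upper bound, from the prime factorisation of `⌊z⌋!`. -/
theorem sum_log_prime_div_le (z : ℝ) :
    ∑ p ∈ Nat.primesLE ⌊z⌋₊, Real.log p / p ≤ 2 * max 1 (Real.log z) := by
  set M := ⌊z⌋₊ with hM
  rcases Nat.eq_zero_or_pos M with h0 | hMpos
  · have : Nat.primesLE M = ∅ := by
      rw [h0]; decide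
    rw [this, sum_empty]; positivity
  have hMR : (0 : ℝ) < M := by exact_mod_cast hMpos
  have hz : (M : ℝ) ≤ z := by
    rw [hM]; exact Nat.floor_le (by by_contra h; simp [Nat.floor_of_nonpos (not_le.mp h).le, hM] at hMpos)
  -- `∑_{n ≤ M} log n = ∑_{n ≤ M} Λ(n) ⌊M / n⌋`, and each floor is at least half of `M / n`.
  have key := ArithmeticFunction.sum_Ioc_mul_zeta_eq_sum ArithmeticFunction.vonMangoldt M
  rw [ArithmeticFunction.vonMangoldt_mul_zeta] at key
  have h1 : ∑ n ∈ Ioc 0 M, ArithmeticFunction.log n ≤ M * Real.log M := by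
    calc ∑ n ∈ Ioc 0 M, ArithmeticFunction.log n ≤ ∑ n ∈ Ioc 0 M, Real.log M := by
          refine sum_le_sum fun n hn => ?_
          rw [mem_Ioc] at hn
          rw [ArithmeticFunction.log_apply]
          exact Real.log_le_log (by exact_mod_cast hn.1) (by exact_mod_cast hn.2)
      _ = M * Real.log M := by simp
  have h2 : (M / 2 : ℝ) * ∑ p ∈ Nat.primesLE M, Real.log p / p
      ≤ ∑ n ∈ Ioc 0 M, ArithmeticFunction.vonMangoldt n * ((M / n : ℕ) : ℝ) := by
    rw [mul_sum]
    calc ∑ p ∈ Nat.primesLE M, (M / 2 : ℝ) * (Real.log p / p)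
        ≤ ∑ p ∈ Nat.primesLE M, ArithmeticFunction.vonMangoldt p * ((M / p : ℕ) : ℝ) := by
          refine sum_le_sum fun p hp => ?_
          have hpp := Nat.prime_of_mem_primesLE hp
          have hpM : p ≤ M := Nat.le_of_mem_primesLE hp
          rw [ArithmeticFunction.vonMangoldt_apply_prime hpp]
          have hp0 : (0 : ℝ) < p := by exact_mod_cast hpp.pos
          have hq : (M : ℝ) / p / 2 ≤ ((M / p : ℕ) : ℝ) := by
            have a1 : 1 ≤ M / p := (Nat.one_le_div_iff hpp.pos).2 hpM
            have a2 : M < p * (M / p + 1) := Nat.lt_mul_div_succ M hpp.pos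
            have a1' : (1 : ℝ) ≤ ((M / p : ℕ) : ℝ) := by exact_mod_cast a1
            have a2' : (M : ℝ) < p * (((M / p : ℕ) : ℝ) + 1) := by exact_mod_cast a2
            rw [div_div, div_le_iff₀ (by positivity)]
            nlinarith
          have hl : 0 ≤ Real.log p := Real.log_natCast_nonneg p
          calc (M / 2 : ℝ) * (Real.log p / p) = Real.log p * (M / p / 2) := by ring
            _ ≤ _ := mul_le_mul_of_nonneg_left hq hl
      _ ≤ _ := by
          refine sum_le_sum_of_subset_of_nonneg ?_ fun n _ _ => ?_
          · intro p hp
            exact mem_Ioc.2 ⟨(Nat.prime_of_mem_primesLE hp).pos, Nat.le_of_mem_primesLE hp⟩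
          · exact mul_nonneg ArithmeticFunction.vonMangoldt_nonneg (Nat.cast_nonneg _)
  have h3 : Real.log M ≤ max 1 (Real.log z) := (Real.log_le_log hMR hz).trans (le_max_right _ _)
  have h4 : (M / 2 : ℝ) * ∑ p ∈ Nat.primesLE M, Real.log p / p ≤ M * Real.log M := by
    rw [key] at h1; exact h2.trans h1
  have h5 : (M : ℝ) * ∑ p ∈ Nat.primesLE M, Real.log p / p ≤ M * (2 * Real.log M) := by linarith
  have := le_of_mul_le_mul_left h5 hMR
  linarith

/-! ### Counting rough numbers -/

theorem IsRough.of_dvd {z : ℝ} {d e : ℕ} (h : IsRough z d) (hed : e ∣ d) : IsRough z e :=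
  fun p hp hpe => h p hp (hpe.trans hed)

/-- A rough number is coprime to every number whose prime factors are all small. -/
theorem IsRough.coprime {z : ℝ} {d k : ℕ} (h : IsRough z d)
    (hk : ∀ p : ℕ, p.Prime → p ∣ k → (p : ℝ) ≤ z) : d.Coprime k :=
  Nat.Coprime.symm <| Nat.coprime_of_dvd fun p hp hpk hpd =>
    absurd (h p hp hpd) (not_lt.2 (hk p hp hpk))

theorem IsRough.lt {z : ℝ} {d : ℕ} (h : IsRough z d) (hd : 1 < d) : z < d :=
  (h _ (Nat.minFac_prime hd.ne') (Nat.minFac_dvd d)).trans_le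
    (by exact_mod_cast Nat.minFac_le (by omega))

open Classical in
/-- The `z`-rough integers in `[1, X]`. -/
noncomputable def roughUpTo (z : ℝ) (X : ℕ) : Finset ℕ :=
  (Finset.Ioc 0 X).filter (IsRough z)

theorem mem_roughUpTo {z : ℝ} {X n : ℕ} :
    n ∈ roughUpTo z X ↔ (0 < n ∧ n ≤ X) ∧ IsRough z n := by
  simp [roughUpTo]

theorem sum_Ioc_inv_eq_harmonic (n : ℕ) :
    ∑ k ∈ Finset.Ioc 0 n, (k : ℝ)⁻¹ = (harmonic n : ℝ) := by
  rw [harmonic_eq_sum_Icc]; push_cast; rfl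

open Finset in
/-- The products `n * k` with `n` rough and `k ≤ z` are pairwise distinct, so the reciprocal sum of
the rough numbers times a harmonic sum of length `z` is a subsum of a harmonic sum. -/
theorem sum_inv_roughUpTo_mul_log_le {z : ℝ} {X : ℕ} (hX : 1 ≤ X) (hz : 0 ≤ z) (hzX : z ≤ X) :
    (∑ n ∈ roughUpTo z X, (n : ℝ)⁻¹) * Real.log z ≤ 1 + 2 * Real.log X := by
  have hfl : ⌊z⌋₊ ≤ X := by
    have := Nat.floor_le_floor hzX
    simpa using this
  have hsmall : ∀ k ∈ Ioc 0 ⌊z⌋₊, ∀ p : ℕ, p.Prime → p ∣ k → (p : ℝ) ≤ z := by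
    intro k hk p _ hpk
    rw [mem_Ioc] at hk
    exact le_trans (by exact_mod_cast (Nat.le_of_dvd hk.1 hpk).trans hk.2) (Nat.floor_le hz)
  have hinj : Set.InjOn (fun x : ℕ × ℕ => x.1 * x.2)
      (roughUpTo z X ×ˢ Ioc 0 ⌊z⌋₊ : Finset (ℕ × ℕ)) := by
    rintro ⟨n, k⟩ h ⟨n', k'⟩ h' heq
    simp only [coe_product, Set.mem_prod, mem_coe] at h h'
    simp only at heq
    have hn := mem_roughUpTo.1 h.1
    have hn' := mem_roughUpTo.1 h'.1
    have c1 : n ∣ n' := (hn.2.coprime (hsmall k' h'.2)).dvd_of_dvd_mul_right (heq ▸ dvd_mul_right n k)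
    have c2 : n' ∣ n := (hn'.2.coprime (hsmall k h.2)).dvd_of_dvd_mul_right (heq ▸ dvd_mul_right n' k')
    have e := Nat.dvd_antisymm c1 c2
    subst e
    simp [Nat.eq_of_mul_eq_mul_left hn.1.1 heq]
  have hsum : 0 ≤ ∑ n ∈ roughUpTo z X, (n : ℝ)⁻¹ := sum_nonneg fun _ _ => by positivity
  calc (∑ n ∈ roughUpTo z X, (n : ℝ)⁻¹) * Real.log z
      ≤ (∑ n ∈ roughUpTo z X, (n : ℝ)⁻¹) * ∑ k ∈ Ioc 0 ⌊z⌋₊, (k : ℝ)⁻¹ := by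
        gcongr
        rw [sum_Ioc_inv_eq_harmonic]
        exact log_le_harmonic_floor z hz
    _ = ∑ x ∈ roughUpTo z X ×ˢ Ioc 0 ⌊z⌋₊, ((x.1 * x.2 : ℕ) : ℝ)⁻¹ := by
        rw [sum_mul_sum, sum_product]
        simp only [Nat.cast_mul, mul_inv]
    _ = ∑ m ∈ (roughUpTo z X ×ˢ Ioc 0 ⌊z⌋₊).image (fun x : ℕ × ℕ => x.1 * x.2), ((m : ℕ) : ℝ)⁻¹ :=
        (sum_image (f := fun m : ℕ => (m : ℝ)⁻¹) hinj).symm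
    _ ≤ ∑ m ∈ Ioc 0 (X * X), (m : ℝ)⁻¹ := by
        refine sum_le_sum_of_subset_of_nonneg ?_ fun _ _ _ => by positivity
        intro m hm
        obtain ⟨⟨n, k⟩, hx, rfl⟩ := mem_image.1 hm
        rw [mem_product] at hx
        have hn := mem_roughUpTo.1 hx.1
        have hk := mem_Ioc.1 hx.2
        exact mem_Ioc.2 ⟨Nat.mul_pos hn.1.1 hk.1, Nat.mul_le_mul hn.1.2 (hk.2.trans hfl)⟩
    _ ≤ 1 + Real.log ((X * X : ℕ) : ℝ) := by
        rw [sum_Ioc_inv_eq_harmonic]; exact harmonic_le_one_add_log _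
    _ = 1 + 2 * Real.log X := by
        have : (X : ℝ) ≠ 0 := by positivity
        rw [Nat.cast_mul, Real.log_mul this this]; ring

open Finset in
/-- Writing `log n` as a divisor sum of `Λ` and using Chebyshev's bound for `ψ`. -/
theorem sum_log_roughUpTo_le (z : ℝ) (X : ℕ) :
    ∑ n ∈ roughUpTo z X, Real.log n ≤ 6 * X * ∑ n ∈ roughUpTo z X, (n : ℝ)⁻¹ := by
  classical
  let r : ArithmeticFunction ℝ := ⟨fun n => if n ≠ 0 ∧ IsRough z n then 1 else 0, by simp⟩
  have hr : ∀ n, r n = if n ≠ 0 ∧ IsRough z n then 1 else 0 := fun _ => rfl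
  have hsum : ∀ F : ℕ → ℝ, ∑ n ∈ roughUpTo z X, F n = ∑ n ∈ Ioc 0 X, r n * F n := by
    intro F
    rw [roughUpTo, sum_filter]
    refine sum_congr rfl fun n hn => ?_
    have : n ≠ 0 := (mem_Ioc.1 hn).1.ne'
    simp [hr, this]
  rw [hsum, hsum, mul_sum]
  calc ∑ n ∈ Ioc 0 X, r n * Real.log n
      ≤ ∑ n ∈ Ioc 0 X, (r * ArithmeticFunction.vonMangoldt) n := by
        refine sum_le_sum fun n _ => ?_
        rw [ArithmeticFunction.mul_apply]
        by_cases h : n ≠ 0 ∧ IsRough z n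
        · rw [hr, if_pos h, one_mul, ← ArithmeticFunction.vonMangoldt_sum,
            Nat.sum_divisorsAntidiagonal' (f := fun a b => r a * ArithmeticFunction.vonMangoldt b)]
          refine sum_le_sum fun i hi => ?_
          have hin := Nat.dvd_of_mem_divisors hi
          have h1 : r (n / i) = 1 := by
            rw [hr, if_pos]
            exact ⟨(Nat.div_pos (Nat.le_of_dvd (Nat.pos_of_ne_zero h.1) hin)
              (Nat.pos_of_mem_divisors hi)).ne', h.2.of_dvd (Nat.div_dvd_of_dvd hin)⟩
          rw [h1, one_mul]
        · rw [hr, if_neg h, zero_mul]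
          refine sum_nonneg fun x _ => mul_nonneg ?_ ArithmeticFunction.vonMangoldt_nonneg
          rw [hr]; split_ifs <;> norm_num
    _ = ∑ n ∈ Ioc 0 X, r n * ∑ m ∈ Ioc 0 (X / n), ArithmeticFunction.vonMangoldt m :=
        ArithmeticFunction.sum_Ioc_mul_eq_sum_sum _ _ _
    _ ≤ ∑ n ∈ Ioc 0 X, 6 * X * (r n * (n : ℝ)⁻¹) := by
        refine sum_le_sum fun n hn => ?_
        have hpsi := Chebyshev.psi_le_const_mul_self (x := ((X / n : ℕ) : ℝ)) (by positivity)
        rw [Chebyshev.psi, Nat.floor_natCast] at hpsi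
        have hlog : Real.log 4 ≤ 2 := by
          have : Real.log 4 = 2 * Real.log 2 := by
            rw [show (4 : ℝ) = 2 ^ 2 by norm_num, Real.log_pow]; norm_num
          have := Real.log_two_lt_d9
          linarith
        have hdiv : ((X / n : ℕ) : ℝ) ≤ X / n := Nat.cast_div_le
        have hr0 : 0 ≤ r n := by rw [hr]; split_ifs <;> norm_num
        calc r n * ∑ m ∈ Ioc 0 (X / n), ArithmeticFunction.vonMangoldt m
            ≤ r n * (6 * (X / n)) := by
              gcongr
              refine hpsi.trans ?_
              have : (0 : ℝ) ≤ ((X / n : ℕ) : ℝ) := by positivity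
              nlinarith
          _ = 6 * X * (r n * (n : ℝ)⁻¹) := by ring

open Finset in
/-- An upper bound sieve: once `X ≥ z`, the `z`-rough integers up to `X` have density
`O(1 / log z)`. -/
theorem card_roughUpTo_le {z : ℝ} {X : ℕ} (hz : 0 ≤ z) (hzX : z ≤ X) :
    ((roughUpTo z X).card : ℝ) ≤ 21 * X / max 1 (Real.log z) := by
  rcases le_or_gt (Real.log z) 1 with h | h
  · rw [max_eq_left h, div_one]
    have : (roughUpTo z X).card ≤ X := by
      simpa using card_le_card (show roughUpTo z X ⊆ Ioc 0 X from
        fun n hn => mem_Ioc.2 (mem_roughUpTo.1 hn).1)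
    have : ((roughUpTo z X).card : ℝ) ≤ X := by exact_mod_cast this
    have : (0 : ℝ) ≤ X := by positivity
    linarith
  rw [max_eq_right h.le, le_div_iff₀ (by linarith)]
  -- `log 0 = 0` excludes `z = 0`
  have hz : 0 < z := hz.lt_of_ne' (by rintro rfl; norm_num at h)
  have hX : 1 ≤ X := by exact_mod_cast Nat.pos_of_ne_zero (by rintro rfl; simp at hzX; linarith)
  have hX0 : (0 : ℝ) < X := by exact_mod_cast hX
  have hlogX : 1 ≤ Real.log X := h.le.trans (Real.log_le_log hz hzX)
  set R := ∑ n ∈ roughUpTo z X, (n : ℝ)⁻¹ with hR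
  -- `log X = log n + log (X / n)`, and `log (X / n) ≤ X / n`.
  have h1 : ((roughUpTo z X).card : ℝ) * Real.log X ≤ 7 * X * R := by
    calc ((roughUpTo z X).card : ℝ) * Real.log X
        = ∑ n ∈ roughUpTo z X, Real.log X := by simp
      _ ≤ ∑ n ∈ roughUpTo z X, (Real.log n + X * (n : ℝ)⁻¹) := by
          refine sum_le_sum fun n hn => ?_
          have hn0 : (0 : ℝ) < n := by exact_mod_cast (mem_roughUpTo.1 hn).1.1
          have := Real.log_le_self (x := X / n) (by positivity)
          rw [Real.log_div hX0.ne' hn0.ne', div_eq_mul_inv] at this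
          linarith
      _ = ∑ n ∈ roughUpTo z X, Real.log n + X * R := by rw [sum_add_distrib, mul_sum]
      _ ≤ 7 * X * R := by linarith [sum_log_roughUpTo_le z X]
  have h2 := sum_inv_roughUpTo_mul_log_le hX hz.le hzX
  have h3 : ((roughUpTo z X).card * Real.log z) * Real.log X ≤ (21 * X) * Real.log X := by
    calc ((roughUpTo z X).card * Real.log z) * Real.log X
        = ((roughUpTo z X).card * Real.log X) * Real.log z := by ring
      _ ≤ (7 * X * R) * Real.log z := by gcongr
      _ = 7 * X * (R * Real.log z) := by ring
      _ ≤ 7 * X * (3 * Real.log X) :=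
          mul_le_mul_of_nonneg_left (h2.trans (by linarith)) (by positivity)
      _ = _ := by ring
  exact le_of_mul_le_mul_right h3 (by linarith)

/-! ### A multiplicative majorant for the number of window divisors -/

/-- The primes `p ≤ z` dividing `n`. -/
noncomputable def smallPrimeFactors (z : ℝ) (n : ℕ) : Finset ℕ :=
  n.primeFactors.filter fun p => ((p : ℕ) : ℝ) ≤ z

theorem mem_smallPrimeFactors {z : ℝ} {n p : ℕ} :
    p ∈ smallPrimeFactors z n ↔ (p.Prime ∧ p ∣ n ∧ n ≠ 0) ∧ (p : ℝ) ≤ z := by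
  simp [smallPrimeFactors]

theorem smoothRadical_pos (z : ℝ) (n : ℕ) : 0 < smoothRadical z n :=
  Finset.prod_pos fun _ hp => (Nat.prime_of_mem_primeFactors (Finset.mem_filter.1 hp).1).pos

open Classical in
/-- The squarefree divisors of `n` all of whose prime factors lie in `(z^{1/2}, z]`. -/
noncomputable def windowDivisors (z : ℝ) (n : ℕ) : Finset ℕ :=
  n.divisors.filter fun d => Squarefree d ∧ PrimesInWindow z d

theorem mem_windowDivisors {z : ℝ} {n d : ℕ} :
    d ∈ windowDivisors z n ↔ (d ∣ n ∧ n ≠ 0) ∧ Squarefree d ∧ PrimesInWindow z d := by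
  simp [windowDivisors]

/-- The quantity `max 1 (log z)`, a positive substitute for `log z` that also serves small `z`. -/
noncomputable def truncLog (z : ℝ) : ℝ := max 1 (Real.log z)

theorem one_le_truncLog (z : ℝ) : 1 ≤ truncLog z := le_max_left _ _

theorem truncLog_pos (z : ℝ) : 0 < truncLog z := one_pos.trans_le (one_le_truncLog z)

/-- The local excess at `p` of the multiplicative majorant: `1 + localExcess z p` is
`2 p^ε` for primes in the window `(z^{1/2}, z]` and `p^ε` for smaller ones,
where `ε = 1 / truncLog z`. -/
noncomputable def localExcess (z : ℝ) (p : ℕ) : ℝ :=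
  (if Real.sqrt z < p then 2 else 1) * (p : ℝ) ^ (truncLog z)⁻¹ - 1

theorem localExcess_nonneg (z : ℝ) {p : ℕ} (hp : 1 ≤ p) : 0 ≤ localExcess z p := by
  have h1 : (1 : ℝ) ≤ (p : ℝ) ^ (truncLog z)⁻¹ :=
    Real.one_le_rpow (by exact_mod_cast hp) (inv_nonneg.2 (truncLog_pos z).le)
  unfold localExcess
  split_ifs <;> linarith

theorem localExcess_le {z : ℝ} {p : ℕ} (hp : p.Prime) (hpz : (p : ℝ) ≤ z) :
    localExcess z p ≤ 10 * Real.log p / truncLog z := by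
  have hp0 : (0 : ℝ) < p := by exact_mod_cast hp.pos
  have hz0 : 0 < z := hp0.trans_le hpz
  have hL := truncLog_pos z
  set t := Real.log p / truncLog z with ht
  have hlogp : 0 ≤ Real.log p := Real.log_natCast_nonneg p
  have ht0 : 0 ≤ t := by positivity
  have ht1 : t ≤ 1 := (div_le_one hL).2 ((Real.log_le_log hp0 hpz).trans (le_max_right _ _))
  have hexp : (p : ℝ) ^ (truncLog z)⁻¹ = Real.exp t := by
    rw [Real.rpow_def_of_pos hp0, ht, div_eq_mul_inv]
  have hle : Real.exp t ≤ 1 + 2 * t := by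
    -- convexity of `exp` on `[0, 1]`
    have := convexOn_exp.2 (Set.mem_univ (0 : ℝ)) (Set.mem_univ (1 : ℝ))
      (show 0 ≤ 1 - t by linarith) ht0 (by ring)
    simp only [smul_eq_mul, mul_zero, mul_one, zero_add, Real.exp_zero] at this
    have := Real.exp_one_lt_d9
    nlinarith
  rw [mul_div_assoc, ← ht, localExcess, hexp]
  split_ifs with hw
  · -- in the window `log p ≥ (log z) / 2`, and `log p ≥ log 2 ≥ 1 / 2` always
    have hhalf : 1 / 2 ≤ t := by
      rw [ht, le_div_iff₀ hL]
      have h2 : Real.log 2 ≤ Real.log p := Real.log_le_log two_pos (by exact_mod_cast hp.two_le)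
      have h3 : Real.log (Real.sqrt z) ≤ Real.log p := Real.log_le_log (Real.sqrt_pos.2 hz0) hw.le
      rw [Real.log_sqrt hz0.le] at h3
      have := Real.log_two_gt_d9
      unfold truncLog
      rcases max_choice 1 (Real.log z) with h | h <;> rw [h] <;> linarith
    linarith
  · linarith

/-- The Euler product of the majorant is bounded, by Mertens' estimate. -/
theorem prod_one_add_localExcess_div_le (z : ℝ) :
    ∏ p ∈ Nat.primesLE ⌊z⌋₊, (1 + localExcess z p / p) ≤ Real.exp 20 := by
  have hL := truncLog_pos z
  have hmem : ∀ p ∈ Nat.primesLE ⌊z⌋₊, p.Prime ∧ (p : ℝ) ≤ z := by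
    intro p hp
    have hpp := Nat.prime_of_mem_primesLE hp
    refine ⟨hpp, ?_⟩
    exact (Nat.le_floor_iff' hpp.ne_zero).1 (Nat.le_of_mem_primesLE hp)
  calc ∏ p ∈ Nat.primesLE ⌊z⌋₊, (1 + localExcess z p / p)
      ≤ ∏ p ∈ Nat.primesLE ⌊z⌋₊, Real.exp (localExcess z p / p) := by
        refine Finset.prod_le_prod (fun p hp => ?_) fun p _ => ?_
        · have := localExcess_nonneg z (hmem p hp).1.one_le
          positivity
        · rw [add_comm]; exact Real.add_one_le_exp _
    _ = Real.exp (∑ p ∈ Nat.primesLE ⌊z⌋₊, localExcess z p / p) := (Real.exp_sum _ _).symm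
    _ ≤ Real.exp 20 := by
        refine Real.exp_le_exp.2 ?_
        calc ∑ p ∈ Nat.primesLE ⌊z⌋₊, localExcess z p / p
            ≤ ∑ p ∈ Nat.primesLE ⌊z⌋₊, 10 / truncLog z * (Real.log p / p) := by
              refine Finset.sum_le_sum fun p hp => ?_
              have := localExcess_le (hmem p hp).1 (hmem p hp).2
              calc localExcess z p / p ≤ 10 * Real.log p / truncLog z / p := by gcongr
                _ = _ := by ring
          _ = 10 / truncLog z * ∑ p ∈ Nat.primesLE ⌊z⌋₊, Real.log p / p := by
              rw [Finset.mul_sum]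
          _ ≤ 10 / truncLog z * (2 * truncLog z) := by
              gcongr
              exact sum_log_prime_div_le z
          _ = 20 := by field_simp; norm_num

theorem card_windowDivisors_le (z : ℝ) (n : ℕ) :
    ((windowDivisors z n).card : ℝ)
      ≤ ∏ p ∈ smallPrimeFactors z n, if Real.sqrt z < p then (2 : ℝ) else 1 := by
  classical
  have h : (windowDivisors z n).card
      ≤ ((smallPrimeFactors z n).filter fun p => Real.sqrt z < (p : ℕ)).powerset.card := by
    refine Finset.card_le_card_of_injOn Nat.primeFactors ?_ ?_
    · intro d hd
      obtain ⟨⟨hdn, hn⟩, _, hw⟩ := mem_windowDivisors.1 (Finset.mem_coe.1 hd)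
      refine Finset.mem_coe.2 (Finset.mem_powerset.2 fun p hp => ?_)
      obtain ⟨hp, hpd, _⟩ := Nat.mem_primeFactors.1 hp
      exact Finset.mem_filter.2
        ⟨mem_smallPrimeFactors.2 ⟨⟨hp, hpd.trans hdn, hn⟩, (hw p hp hpd).2⟩, (hw p hp hpd).1⟩
    · intro d hd e he hde
      have hd := (mem_windowDivisors.1 (Finset.mem_coe.1 hd)).2.1
      have he := (mem_windowDivisors.1 (Finset.mem_coe.1 he)).2.1
      rw [← Nat.prod_primeFactors_of_squarefree hd, ← Nat.prod_primeFactors_of_squarefree he, hde]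
  rw [Finset.card_powerset] at h
  rw [Finset.prod_ite, Finset.prod_const, Finset.prod_const_one, mul_one]
  exact_mod_cast h

/-- `(number of window divisors of n) * P_z(n)^ε` is at most a divisor sum with nonnegative
coefficients supported on products of distinct primes up to `z`. -/
theorem card_windowDivisors_mul_rpow_le (z : ℝ) (n : ℕ) :
    (windowDivisors z n).card * (smoothRadical z n : ℝ) ^ (truncLog z)⁻¹
      ≤ ∑ B ∈ (smallPrimeFactors z n).powerset, ∏ p ∈ B, localExcess z p := by
  rw [← Finset.prod_one_add]
  have h : (smoothRadical z n : ℝ) ^ (truncLog z)⁻¹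
      = ∏ p ∈ smallPrimeFactors z n, (p : ℝ) ^ (truncLog z)⁻¹ := by
    rw [Real.finsetProd_rpow _ _ fun _ _ => Nat.cast_nonneg _, smoothRadical, Nat.cast_prod]
    rfl
  rw [h]
  calc _ ≤ (∏ p ∈ smallPrimeFactors z n, if Real.sqrt z < p then (2 : ℝ) else 1)
        * ∏ p ∈ smallPrimeFactors z n, (p : ℝ) ^ (truncLog z)⁻¹ := by
        gcongr
        · exact card_windowDivisors_le z n
    _ = ∏ p ∈ smallPrimeFactors z n, (1 + localExcess z p) := by
        rw [← Finset.prod_mul_distrib]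
        refine Finset.prod_congr rfl fun p _ => ?_
        rw [localExcess]; ring

/-- Weighted averages of the majorant: if the weights `w` have total mass at most `A / ∏ B` over the
multiples of `∏ B`, for each set `B` of primes up to `z`, then the weighted sum of the majorant
is `O(A)`. -/
theorem sum_weight_mul_card_windowDivisors_le (z : ℝ) (S : Finset ℕ) (w : ℕ → ℝ) {A : ℝ}
    (hA : 0 ≤ A) (hw : ∀ m ∈ S, 0 ≤ w m)
    (hS : ∀ b : ℕ, 0 < b → ∑ m ∈ S with b ∣ m, w m ≤ A / b) :
    ∑ m ∈ S, w m * ((windowDivisors z m).card * (smoothRadical z m : ℝ) ^ (truncLog z)⁻¹)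
      ≤ A * Real.exp 20 := by
  classical
  set Q := Nat.primesLE ⌊z⌋₊ with hQ
  have hQp : ∀ p ∈ Q, p.Prime := fun p hp => Nat.prime_of_mem_primesLE hp
  have hprod : ∀ B ∈ Q.powerset, 0 ≤ ∏ p ∈ B, localExcess z p := fun B hB =>
    Finset.prod_nonneg fun p hp =>
      localExcess_nonneg z (hQp p (Finset.mem_powerset.1 hB hp)).one_le
  have hpt : ∀ m : ℕ, ∑ B ∈ (smallPrimeFactors z m).powerset, ∏ p ∈ B, localExcess z p
      ≤ ∑ B ∈ Q.powerset, if (∏ p ∈ B, p) ∣ m then ∏ p ∈ B, localExcess z p else 0 := by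
    intro m
    rw [← Finset.sum_filter]
    refine Finset.sum_le_sum_of_subset_of_nonneg (fun B hB => ?_)
      fun B hB _ => hprod B (Finset.mem_filter.1 hB).1
    rw [Finset.mem_powerset] at hB
    refine Finset.mem_filter.2 ⟨Finset.mem_powerset.2 fun p hp => ?_, ?_⟩
    · obtain ⟨⟨hp, _, _⟩, hpz⟩ := mem_smallPrimeFactors.1 (hB hp)
      exact Nat.mem_primesLE.2 ⟨Nat.le_floor hpz, hp⟩
    · exact Finset.prod_primes_dvd _ (fun p hp => (mem_smallPrimeFactors.1 (hB hp)).1.1.prime)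
        fun p hp => (mem_smallPrimeFactors.1 (hB hp)).1.2.1
  calc _ ≤ ∑ m ∈ S, w m *
        ∑ B ∈ Q.powerset, if (∏ p ∈ B, p) ∣ m then ∏ p ∈ B, localExcess z p else 0 :=
        Finset.sum_le_sum fun m hm => mul_le_mul_of_nonneg_left
          ((card_windowDivisors_mul_rpow_le z m).trans (hpt m)) (hw m hm)
    _ = ∑ B ∈ Q.powerset, (∏ p ∈ B, localExcess z p) * ∑ m ∈ S with (∏ p ∈ B, p) ∣ m, w m := by
        simp_rw [Finset.mul_sum]
        rw [Finset.sum_comm]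
        refine Finset.sum_congr rfl fun B _ => ?_
        rw [Finset.sum_filter]
        refine Finset.sum_congr rfl fun m _ => ?_
        split_ifs <;> ring
    _ ≤ ∑ B ∈ Q.powerset, A * ∏ p ∈ B, (localExcess z p / p) := by
        refine Finset.sum_le_sum fun B hB => ?_
        have hpos : 0 < ∏ p ∈ B, p :=
          Finset.prod_pos fun p hp => (hQp p (Finset.mem_powerset.1 hB hp)).pos
        calc _ ≤ (∏ p ∈ B, localExcess z p) * (A / ((∏ p ∈ B, p : ℕ) : ℝ)) :=
              mul_le_mul_of_nonneg_left (hS _ hpos) (hprod B hB)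
          _ = _ := by rw [Finset.prod_div_distrib, Nat.cast_prod]; ring
    _ = A * ∏ p ∈ Q, (1 + localExcess z p / p) := by rw [← Finset.mul_sum, Finset.prod_one_add]
    _ ≤ A * Real.exp 20 := mul_le_mul_of_nonneg_left (prod_one_add_localExcess_div_le z) hA

/-- The function counting window divisors is bounded on average. -/
theorem sum_card_windowDivisors_le (z : ℝ) (K : ℕ) :
    ∑ m ∈ Finset.Ioc 0 K, ((windowDivisors z m).card : ℝ) ≤ K * Real.exp 20 := by
  refine le_trans (Finset.sum_le_sum fun m _ => ?_)
    (sum_weight_mul_card_windowDivisors_le z (Finset.Ioc 0 K) (fun _ => 1) (Nat.cast_nonneg K)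
      (fun _ _ => zero_le_one) fun b _ => ?_)
  · rw [one_mul]
    refine le_mul_of_one_le_right (Nat.cast_nonneg _)
      (Real.one_le_rpow ?_ (inv_nonneg.2 (truncLog_pos z).le))
    exact_mod_cast smoothRadical_pos z m
  · rw [Finset.sum_const, nsmul_eq_mul, mul_one, Nat.Ioc_filter_dvd_card_eq_div]
    exact Nat.cast_div_le

/-! ### Rankin's trick -/

/-- Telescoping comparison of `k^{-1-ε}` with the integral of `x^{-1-ε}`. -/
theorem rpow_neg_one_sub_le {ε x : ℝ} (hε : 0 < ε) (hε1 : ε ≤ 1) (hx : 1 < x) :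
    x ^ (-(1 + ε)) ≤ ε⁻¹ * ((x - 1) ^ (-ε) - x ^ (-ε)) := by
  have hx0 : 0 < x := by linarith
  have hinv : x⁻¹ < 1 := inv_lt_one_of_one_lt₀ hx
  have hinv0 : 0 < x⁻¹ := inv_pos.2 hx0
  have hb : (1 + -x⁻¹) ^ ε ≤ 1 + ε * -x⁻¹ :=
    rpow_one_add_le_one_add_mul_self (by linarith) hε.le hε1
  have hpos : 0 < (1 + -x⁻¹) ^ ε := Real.rpow_pos_of_pos (by linarith) _
  have h1 : 1 + ε * x⁻¹ ≤ (1 + -x⁻¹) ^ (-ε) := by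
    rw [Real.rpow_neg (by linarith), ← one_div ((1 + -x⁻¹) ^ ε), le_div_iff₀ hpos]
    nlinarith [mul_nonneg hε.le hinv0.le]
  have h2 : (x - 1) ^ (-ε) = x ^ (-ε) * (1 + -x⁻¹) ^ (-ε) := by
    rw [← Real.mul_rpow hx0.le (by linarith)]
    congr 1; field_simp; ring
  have h3 : x ^ (-(1 + ε)) = x ^ (-ε) * x⁻¹ := by
    rw [show -(1 + ε) = -ε + -1 by ring, Real.rpow_add hx0, Real.rpow_neg_one]
  have h4 : 0 < x ^ (-ε) := Real.rpow_pos_of_pos hx0 _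
  rw [h2, h3, ← mul_le_mul_iff_right₀ hε, mul_inv_cancel_left₀ hε.ne']
  nlinarith

/-- A tail bound for the zeta series, uniform in the starting point `T > 0`. -/
theorem sum_rpow_tail_le {ε T : ℝ} (hε : 0 < ε) (hε1 : ε ≤ 1) (hT : 0 < T) (K : ℕ) :
    ∑ k ∈ Finset.Ioc 0 K with T < ((k : ℕ) : ℝ), (k : ℝ) ^ (-(1 + ε)) ≤ (1 + ε⁻¹) * T ^ (-ε) := by
  set J := ⌊T⌋₊ + 1 with hJ
  have hJT : T < J := by rw [hJ]; exact_mod_cast Nat.lt_floor_add_one T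
  have hJ1 : (1 : ℝ) ≤ J := by rw [hJ]; push_cast; linarith [Nat.cast_nonneg (α := ℝ) ⌊T⌋₊]
  have hJ0 : (0 : ℝ) < J := by linarith
  have hJε : (J : ℝ) ^ (-ε) ≤ T ^ (-ε) := Real.rpow_le_rpow_of_nonpos hT hJT.le (by linarith)
  have hfirst : (J : ℝ) ^ (-(1 + ε)) ≤ (J : ℝ) ^ (-ε) :=
    Real.rpow_le_rpow_of_exponent_le hJ1 (by linarith)
  have htel : ∀ i : ℕ, ∑ k ∈ Finset.Ico J (J + i + 1), (k : ℝ) ^ (-(1 + ε))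
      ≤ (J : ℝ) ^ (-ε) + ε⁻¹ * ((J : ℝ) ^ (-ε) - ((J + i : ℕ) : ℝ) ^ (-ε)) := by
    intro i
    induction i with
    | zero => simpa using hfirst
    | succ i ih =>
      rw [show J + (i + 1) + 1 = (J + i + 1) + 1 by ring, Finset.sum_Ico_succ_top (by omega)]
      have hi0 : (0 : ℝ) ≤ i := Nat.cast_nonneg i
      have := rpow_neg_one_sub_le (x := ((J + i + 1 : ℕ) : ℝ)) hε hε1 (by push_cast; linarith)
      rw [show (((J + i + 1 : ℕ) : ℝ) - 1) = ((J + i : ℕ) : ℝ) by push_cast; ring] at this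
      rw [show J + (i + 1) = J + i + 1 by ring]
      linarith
  have hKε : 0 ≤ ((J + K : ℕ) : ℝ) ^ (-ε) := Real.rpow_nonneg (Nat.cast_nonneg _) _
  calc _ ≤ ∑ k ∈ Finset.Ico J (J + K + 1), (k : ℝ) ^ (-(1 + ε)) := by
        refine Finset.sum_le_sum_of_subset_of_nonneg (fun k hk => ?_)
          fun k _ _ => Real.rpow_nonneg (Nat.cast_nonneg _) _
        obtain ⟨hk, hTk⟩ := Finset.mem_filter.1 hk
        have := (Nat.floor_lt hT.le).2 hTk
        rw [Finset.mem_Ioc] at hk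
        exact Finset.mem_Ico.2 ⟨by omega, by omega⟩
    _ ≤ _ := htel K
    _ ≤ (1 + ε⁻¹) * (J : ℝ) ^ (-ε) := by
        have := mul_nonneg (inv_nonneg.2 hε.le) hKε
        linarith
    _ ≤ _ := by gcongr

theorem sum_rpow_tail_multiples_le {ε Y : ℝ} (hε : 0 < ε) (hε1 : ε ≤ 1) (hY : 0 < Y)
    (K : ℕ) {b : ℕ} (hb : 0 < b) :
    ∑ m ∈ (Finset.Ioc 0 K).filter (fun m : ℕ => Y < (m : ℝ)) with b ∣ m, (m : ℝ) ^ (-(1 + ε))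
      ≤ (1 + ε⁻¹) * Y ^ (-ε) / b := by
  have hb0 : (0 : ℝ) < b := by exact_mod_cast hb
  calc _ ≤ ∑ m ∈ ((Finset.Ioc 0 K).filter (fun k : ℕ => Y / b < (k : ℝ))).image (b * ·),
        (m : ℝ) ^ (-(1 + ε)) := by
        refine Finset.sum_le_sum_of_subset_of_nonneg (fun m hm => ?_)
          fun k _ _ => Real.rpow_nonneg (Nat.cast_nonneg _) _
        obtain ⟨hm, k, rfl⟩ := Finset.mem_filter.1 hm
        obtain ⟨hm, hYm⟩ := Finset.mem_filter.1 hm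
        rw [Finset.mem_Ioc] at hm
        refine Finset.mem_image.2 ⟨k, Finset.mem_filter.2 ⟨Finset.mem_Ioc.2 ⟨?_, ?_⟩, ?_⟩, rfl⟩
        · exact Nat.pos_of_mul_pos_left hm.1
        · exact (Nat.le_mul_of_pos_left k hb).trans hm.2
        · rw [div_lt_iff₀ hb0, mul_comm]; exact_mod_cast hYm
    _ = ∑ k ∈ Finset.Ioc 0 K with Y / b < ((k : ℕ) : ℝ),
          (b : ℝ) ^ (-(1 + ε)) * (k : ℝ) ^ (-(1 + ε)) := by
        rw [Finset.sum_image fun x _ y _ h => Nat.eq_of_mul_eq_mul_left hb h]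
        refine Finset.sum_congr rfl fun k _ => ?_
        rw [Nat.cast_mul, Real.mul_rpow hb0.le (Nat.cast_nonneg _)]
    _ ≤ (b : ℝ) ^ (-(1 + ε)) * ((1 + ε⁻¹) * (Y / b) ^ (-ε)) := by
        rw [← Finset.mul_sum]
        gcongr
        exact sum_rpow_tail_le hε hε1 (by positivity) K
    _ = _ := by
        rw [Real.div_rpow hY.le hb0.le, show -(1 + ε) = -ε + -1 by ring, Real.rpow_add hb0,
          Real.rpow_neg_one]
        have := (Real.rpow_pos_of_pos hb0 (-ε)).ne'
        field_simp

/-- Rankin's trick: the condition `m < 4 Y P_z(m)` is relaxed to the factor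
`(4 Y P_z(m) / m)^ε`, with `ε = 1 / truncLog z` so that `P_z(m)^ε` stays bounded on average. -/
theorem sum_card_windowDivisors_div_le (z : ℝ) {Y : ℝ} (hY : 0 < Y) (K : ℕ) :
    ∑ m ∈ Finset.Ioc 0 K with Y < ((m : ℕ) : ℝ) ∧ (m : ℝ) < 4 * Y * smoothRadical z m,
      ((windowDivisors z m).card : ℝ) / m ≤ 8 * truncLog z * Real.exp 20 := by
  have hL := truncLog_pos z
  have hL1 := one_le_truncLog z
  set ε := (truncLog z)⁻¹ with hεdef
  have hε : 0 < ε := inv_pos.2 hL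
  have hε1 : ε ≤ 1 := inv_le_one_of_one_le₀ hL1
  have h4Y : 0 < 4 * Y := by positivity
  have hmain := sum_weight_mul_card_windowDivisors_le z
    ((Finset.Ioc 0 K).filter (fun m : ℕ => Y < (m : ℝ))) (fun m => (m : ℝ) ^ (-(1 + ε)))
    (A := (1 + ε⁻¹) * Y ^ (-ε)) (by positivity)
    (fun m _ => Real.rpow_nonneg (Nat.cast_nonneg _) _)
    (fun b hb => sum_rpow_tail_multiples_le hε hε1 hY K hb)
  calc _ ≤ ∑ m ∈ Finset.Ioc 0 K with Y < ((m : ℕ) : ℝ) ∧ (m : ℝ) < 4 * Y * smoothRadical z m,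
        (4 * Y) ^ ε * ((m : ℝ) ^ (-(1 + ε)) *
          ((windowDivisors z m).card * (smoothRadical z m : ℝ) ^ ε)) := by
        refine Finset.sum_le_sum fun m hm => ?_
        obtain ⟨hm, _, hlt⟩ := Finset.mem_filter.1 hm
        have hm0 : (0 : ℝ) < m := by exact_mod_cast (Finset.mem_Ioc.1 hm).1
        have h1 : (m : ℝ) ^ ε ≤ (4 * Y) ^ ε * (smoothRadical z m : ℝ) ^ ε := by
          rw [← Real.mul_rpow h4Y.le (Nat.cast_nonneg _)]
          exact Real.rpow_le_rpow hm0.le hlt.le hε.le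
        have h2 : (m : ℝ) ^ ε * (m : ℝ) ^ (-(1 + ε)) = (m : ℝ)⁻¹ := by
          rw [← Real.rpow_add hm0, show ε + -(1 + ε) = -1 by ring, Real.rpow_neg_one]
        calc ((windowDivisors z m).card : ℝ) / m
            = (windowDivisors z m).card * (m : ℝ) ^ (-(1 + ε)) * (m : ℝ) ^ ε := by
              rw [div_eq_mul_inv, ← h2]; ring
          _ ≤ (windowDivisors z m).card * (m : ℝ) ^ (-(1 + ε)) *
                ((4 * Y) ^ ε * (smoothRadical z m : ℝ) ^ ε) := by gcongr
          _ = _ := by ring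
    _ ≤ ∑ m ∈ (Finset.Ioc 0 K).filter (fun m : ℕ => Y < (m : ℝ)),
        (4 * Y) ^ ε * ((m : ℝ) ^ (-(1 + ε)) *
          ((windowDivisors z m).card * (smoothRadical z m : ℝ) ^ ε)) := by
        refine Finset.sum_le_sum_of_subset_of_nonneg (fun m hm => ?_) fun m _ _ => by positivity
        obtain ⟨hm, h, _⟩ := Finset.mem_filter.1 hm
        exact Finset.mem_filter.2 ⟨hm, h⟩
    _ ≤ (4 * Y) ^ ε * ((1 + ε⁻¹) * Y ^ (-ε) * Real.exp 20) := by
        rw [← Finset.mul_sum]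
        gcongr
    _ = (4 : ℝ) ^ ε * (1 + truncLog z) * Real.exp 20 := by
        have h3 : Y ^ ε * Y ^ (-ε) = 1 := by rw [← Real.rpow_add hY]; simp
        rw [Real.mul_rpow (by norm_num) hY.le, hεdef, inv_inv, ← hεdef]
        linear_combination ((4 : ℝ) ^ ε * (1 + truncLog z) * Real.exp 20) * h3
    _ ≤ 4 * (2 * truncLog z) * Real.exp 20 := by
        have h4 : (4 : ℝ) ^ ε ≤ 4 := by
          simpa using Real.rpow_le_rpow_of_exponent_le (x := 4) (by norm_num) hε1
        gcongr
        linarith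
    _ = _ := by ring

/-! ### Splitting off the rough divisor -/

theorem smallPrimeFactors_mul {z : ℝ} {d m : ℕ} (hd : IsRough z d) (hd0 : d ≠ 0) :
    smallPrimeFactors z (d * m) = smallPrimeFactors z m := by
  ext p
  simp only [mem_smallPrimeFactors]
  constructor
  · rintro ⟨⟨hp, hpdm, h0⟩, hpz⟩
    refine ⟨⟨hp, ?_, right_ne_zero_of_mul h0⟩, hpz⟩
    exact (hp.dvd_mul.1 hpdm).resolve_left fun h => absurd (hd p hp h) (not_lt.2 hpz)
  · rintro ⟨⟨hp, hpm, h0⟩, hpz⟩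
    exact ⟨⟨hp, hpm.mul_left d, mul_ne_zero hd0 h0⟩, hpz⟩

theorem smoothRadical_mul {z : ℝ} {d m : ℕ} (hd : IsRough z d) (hd0 : d ≠ 0) :
    smoothRadical z (d * m) = smoothRadical z m :=
  congrArg (fun s : Finset ℕ => ∏ p ∈ s, p) (smallPrimeFactors_mul hd hd0)

theorem windowDivisors_mul {z : ℝ} {d m : ℕ} (hd : IsRough z d) (hd0 : d ≠ 0) :
    windowDivisors z (d * m) = windowDivisors z m := by
  ext e
  simp only [mem_windowDivisors]
  constructor
  · rintro ⟨⟨he, h0⟩, hsq, hw⟩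
    have hc := hd.coprime fun p hp hpe => (hw p hp hpe).2
    exact ⟨⟨hc.symm.dvd_of_dvd_mul_left he, right_ne_zero_of_mul h0⟩, hsq, hw⟩
  · rintro ⟨⟨he, h0⟩, h⟩
    exact ⟨⟨he.mul_left d, mul_ne_zero hd0 h0⟩, h⟩

open Classical in
/-- The rough divisors `d` of `n` with `a / P_z(n) < d ≤ 2a`. -/
noncomputable def roughDivisors (z a : ℝ) (n : ℕ) : Finset ℕ :=
  n.divisors.filter fun d =>
    IsRough z d ∧ a / (smoothRadical z n : ℝ) < (d : ℝ) ∧ (d : ℝ) ≤ 2 * a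

theorem mem_roughDivisors {z a : ℝ} {n d : ℕ} :
    d ∈ roughDivisors z a n ↔ (d ∣ n ∧ n ≠ 0) ∧ IsRough z d ∧
      a / (smoothRadical z n : ℝ) < (d : ℝ) ∧ (d : ℝ) ≤ 2 * a := by
  simp [roughDivisors]

theorem pairCount_eq (z a : ℝ) (n : ℕ) :
    pairCount z a n = (roughDivisors z a n).card * (windowDivisors z n).card := by
  simp [pairCount, roughDivisors, windowDivisors]

theorem half_le_card_dyadicRange {N : ℝ} (hN : 1 / 2 ≤ N) :
    N / 2 ≤ ((dyadicRange N).card : ℝ) := by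
  rw [dyadicRange, Nat.card_Ioc]
  have h1 : (⌊N⌋₊ : ℝ) ≤ N := Nat.floor_le (by linarith)
  have h2 : 2 * N < ⌊2 * N⌋₊ + 1 := Nat.lt_floor_add_one _
  have h3 : ⌊N⌋₊ + 1 ≤ ⌊2 * N⌋₊ := by
    rw [Nat.le_floor_iff (by linarith)]
    push_cast
    rcases lt_or_ge N 1 with h | h
    · rw [Nat.floor_eq_zero.2 h]; norm_num; linarith
    · linarith
  rw [Nat.cast_sub (by omega)]
  have h4 : (⌊N⌋₊ : ℝ) + 1 ≤ ⌊2 * N⌋₊ := by exact_mod_cast h3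
  rcases lt_or_ge N 2 with h | h <;> linarith

/-- For fixed cofactor `m`, the rough numbers `1 < d ≤ 2N / m`: if there are any, then
`2N / m ≥ z` and the sieve bound applies. -/
theorem card_roughUpTo_filter_one_lt_le {z x : ℝ} (hz : 0 ≤ z) (hx : 0 ≤ x) :
    (((roughUpTo z ⌊x⌋₊).filter (1 < ·)).card : ℝ) ≤ 21 * x / truncLog z := by
  have hL := truncLog_pos z
  rcases Finset.eq_empty_or_nonempty ((roughUpTo z ⌊x⌋₊).filter (1 < ·)) with h | ⟨d, hd⟩
  · rw [h, Finset.card_empty, Nat.cast_zero]; positivity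
  · obtain ⟨hd, hd1⟩ := Finset.mem_filter.1 hd
    obtain ⟨⟨_, hdx⟩, hr⟩ := mem_roughUpTo.1 hd
    have hzx : z ≤ ⌊x⌋₊ := (hr.lt hd1).le.trans (by exact_mod_cast hdx)
    calc (((roughUpTo z ⌊x⌋₊).filter (1 < ·)).card : ℝ) ≤ (roughUpTo z ⌊x⌋₊).card := by
          exact_mod_cast Finset.card_filter_le _ _
      _ ≤ 21 * ⌊x⌋₊ / truncLog z := card_roughUpTo_le hz hzx
      _ ≤ 21 * x / truncLog z := by
          gcongr
          exact Nat.floor_le hx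

/-- The contribution of the rough divisors `d > 1`, reorganised by the cofactor `m = n / d`:
the size conditions on `n` and `d` place `m` between `Y` and `4 Y P_z(m)`, with `Y = N / 2a`. -/
theorem sum_roughDivisors_one_lt_le {z N a : ℝ} (hz : 0 ≤ z) (hN : 0 < N) (ha : 0 < a) :
    ∑ n ∈ dyadicRange N, ∑ _d ∈ (roughDivisors z a n).filter (1 < ·),
      ((windowDivisors z n).card : ℝ) ≤ 336 * N * Real.exp 20 := by
  classical
  set K := ⌊2 * N⌋₊ with hK
  have hL := truncLog_pos z
  set M := (Finset.Ioc 0 K).filter (fun m : ℕ => N / (2 * a) < (m : ℝ) ∧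
    (m : ℝ) < 4 * (N / (2 * a)) * smoothRadical z m) with hM
  set E : ℕ → Finset ℕ := fun m => (roughUpTo z ⌊2 * N / m⌋₊).filter (1 < ·) with hE
  set D := (dyadicRange N).sigma fun n => (roughDivisors z a n).filter (1 < ·) with hD
  set G : (_ : ℕ) × ℕ → (_ : ℕ) × ℕ := fun x => ⟨x.1 / x.2, x.2⟩ with hG
  have hDmem : ∀ x ∈ D, ∃ m : ℕ, x.1 = x.2 * m ∧ 1 < x.2 ∧ IsRough z x.2 ∧ m ∈ M ∧ x.2 ∈ E m := by
    rintro ⟨n, d⟩ hx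
    obtain ⟨hn, hd⟩ := Finset.mem_sigma.1 hx
    dsimp only at hn hd
    obtain ⟨hd, hd1⟩ := Finset.mem_filter.1 hd
    obtain ⟨⟨⟨m, rfl⟩, hn0⟩, hr, hlow, hup⟩ := mem_roughDivisors.1 hd
    obtain ⟨hn1, hn2⟩ := (mem_dyadicRange hN.le _).1 hn
    dsimp only
    have hm : 0 < m := Nat.pos_of_ne_zero (right_ne_zero_of_mul hn0)
    have hd0 : 0 < d := by omega
    have hmR : (0 : ℝ) < m := by exact_mod_cast hm
    have hdR : (0 : ℝ) < d := by exact_mod_cast hd0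
    rw [smoothRadical_mul hr hd0.ne'] at hlow
    have hP : (0 : ℝ) < smoothRadical z m := by exact_mod_cast smoothRadical_pos z m
    rw [div_lt_iff₀ hP] at hlow
    have hn2' := hn2
    push_cast at hn1 hn2
    refine ⟨m, rfl, hd1, hr, Finset.mem_filter.2 ⟨Finset.mem_Ioc.2 ⟨hm, ?_⟩, ?_, ?_⟩,
      Finset.mem_filter.2 ⟨mem_roughUpTo.2 ⟨⟨hd0, Nat.le_floor ?_⟩, hr⟩, hd1⟩⟩
    · exact (Nat.le_mul_of_pos_left m hd0).trans (Nat.le_floor hn2')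
    · rw [div_lt_iff₀ (by positivity)]
      nlinarith
    · rw [show 4 * (N / (2 * a)) * (smoothRadical z m : ℝ) = 2 * N * smoothRadical z m / a by
        field_simp; ring, lt_div_iff₀ ha]
      nlinarith
    · rw [le_div_iff₀ hmR]; exact hn2
  have hGval : ∀ x ∈ D, ∀ m : ℕ, x.1 = x.2 * m → 1 < x.2 → x.1 / x.2 = m := by
    intro x _ m h h1
    rw [h, Nat.mul_div_cancel_left _ (by omega)]
  have hinj : Set.InjOn G D := by
    intro x hx y hy hxy
    obtain ⟨m, hxm, hx1, -⟩ := hDmem x hx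
    obtain ⟨m', hym, hy1, -⟩ := hDmem y hy
    have e : (⟨m, x.2⟩ : (_ : ℕ) × ℕ) = ⟨m', y.2⟩ := by
      have := hxy
      simp only [hG] at this
      rwa [hGval x hx m hxm hx1, hGval y hy m' hym hy1] at this
    obtain ⟨n, d⟩ := x
    obtain ⟨n', d'⟩ := y
    simp only [Sigma.mk.injEq, heq_eq_eq] at e
    dsimp only at hxm hym
    rw [hxm, hym, e.1, e.2]
  calc ∑ n ∈ dyadicRange N, ∑ _d ∈ (roughDivisors z a n).filter (1 < ·),
        ((windowDivisors z n).card : ℝ)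
      = ∑ x ∈ D, ((windowDivisors z x.1).card : ℝ) := by rw [hD, Finset.sum_sigma]
    _ = ∑ x ∈ D, ((windowDivisors z (G x).1).card : ℝ) := by
        refine Finset.sum_congr rfl fun x hx => ?_
        obtain ⟨m, hxm, hx1, hr, -⟩ := hDmem x hx
        rw [show (G x).1 = m from hGval x hx m hxm hx1, hxm, windowDivisors_mul hr (by omega)]
    _ = ∑ y ∈ D.image G, ((windowDivisors z y.1).card : ℝ) :=
        (Finset.sum_image (f := fun y : (_ : ℕ) × ℕ => ((windowDivisors z y.1).card : ℝ)) hinj).symm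
    _ ≤ ∑ y ∈ M.sigma E, ((windowDivisors z y.1).card : ℝ) := by
        refine Finset.sum_le_sum_of_subset_of_nonneg (fun y hy => ?_) fun _ _ _ => by positivity
        obtain ⟨x, hx, rfl⟩ := Finset.mem_image.1 hy
        obtain ⟨m, hxm, hx1, -, hmM, hE⟩ := hDmem x hx
        refine Finset.mem_sigma.2 ?_
        rw [show (G x).1 = m from hGval x hx m hxm hx1]
        exact ⟨hmM, hE⟩
    _ = ∑ m ∈ M, ((E m).card : ℝ) * (windowDivisors z m).card := by
        rw [Finset.sum_sigma]; simp
    _ ≤ ∑ m ∈ M, 42 * N / truncLog z * (((windowDivisors z m).card : ℝ) / m) := by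
        refine Finset.sum_le_sum fun m _ => ?_
        have := card_roughUpTo_filter_one_lt_le (x := 2 * N / m) hz (by positivity)
        calc ((E m).card : ℝ) * (windowDivisors z m).card
            ≤ 21 * (2 * N / m) / truncLog z * (windowDivisors z m).card := by gcongr
          _ = _ := by ring
    _ ≤ 42 * N / truncLog z * (8 * truncLog z * Real.exp 20) := by
        rw [← Finset.mul_sum]
        gcongr
        exact sum_card_windowDivisors_div_le z (by positivity) K
    _ = 336 * N * Real.exp 20 := by field_simp; norm_num

theorem lemma3p1 :
    ∃ C : ℝ, ∀ z N a : ℝ, 0 ≤ z → 1 / 2 ≤ N → expectedPairCount z N a ≤ C := by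
  classical
  refine ⟨676 * Real.exp 20, fun z N a hz hN => ?_⟩
  have hN0 : 0 < N := by linarith
  have hcard := half_le_card_dyadicRange hN
  have hpos : (0 : ℝ) < (dyadicRange N).card := by linarith
  rw [expectedPairCount, div_le_iff₀ hpos]
  have hexp := Real.exp_pos 20
  suffices h : ∑ n ∈ dyadicRange N, (pairCount z a n : ℝ) ≤ 338 * N * Real.exp 20 by nlinarith
  rcases le_or_gt a 0 with ha | ha
  · -- no positive integer `d` satisfies `d ≤ 2a`
    have h0 : ∀ n ∈ dyadicRange N, (pairCount z a n : ℝ) = 0 := by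
      intro n _
      have : roughDivisors z a n = ∅ := by
        refine Finset.eq_empty_of_forall_notMem fun d hd => ?_
        obtain ⟨⟨hdn, hn⟩, _, _, hup⟩ := mem_roughDivisors.1 hd
        have : (0 : ℝ) < d := by exact_mod_cast Nat.pos_of_dvd_of_pos hdn (Nat.pos_of_ne_zero hn)
        linarith
      rw [pairCount_eq, this]; simp
    rw [Finset.sum_eq_zero h0]; positivity
  have hsplit : ∀ n : ℕ, (pairCount z a n : ℝ) ≤ (windowDivisors z n).card +
      ∑ _d ∈ (roughDivisors z a n).filter (1 < ·), ((windowDivisors z n).card : ℝ) := by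
    intro n
    have h1 : (roughDivisors z a n).card ≤ 1 + ((roughDivisors z a n).filter (1 < ·)).card := by
      rw [← Finset.card_filter_add_card_filter_not (s := roughDivisors z a n) (1 < ·), add_comm]
      refine Nat.add_le_add_right (Finset.card_le_one.2 fun x hx y hy => ?_) _
      obtain ⟨hx, hx1⟩ := Finset.mem_filter.1 hx
      obtain ⟨hy, hy1⟩ := Finset.mem_filter.1 hy
      obtain ⟨hxn, hn⟩ := (mem_roughDivisors.1 hx).1
      have := Nat.pos_of_dvd_of_pos hxn (Nat.pos_of_ne_zero hn)
      have := Nat.pos_of_dvd_of_pos (mem_roughDivisors.1 hy).1.1 (Nat.pos_of_ne_zero hn)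
      omega
    have h2 : ((roughDivisors z a n).card : ℝ)
        ≤ 1 + ((roughDivisors z a n).filter (1 < ·)).card := by exact_mod_cast h1
    rw [pairCount_eq, Nat.cast_mul, Finset.sum_const, nsmul_eq_mul]
    have h3 : (0 : ℝ) ≤ (windowDivisors z n).card := Nat.cast_nonneg _
    nlinarith
  have hone : ∑ n ∈ dyadicRange N, ((windowDivisors z n).card : ℝ) ≤ 2 * N * Real.exp 20 := by
    calc _ ≤ ∑ n ∈ Finset.Ioc 0 ⌊2 * N⌋₊, ((windowDivisors z n).card : ℝ) :=
          Finset.sum_le_sum_of_subset_of_nonneg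
            (Finset.Ioc_subset_Ioc_left (Nat.zero_le _)) fun _ _ _ => Nat.cast_nonneg _
      _ ≤ ⌊2 * N⌋₊ * Real.exp 20 := sum_card_windowDivisors_le z _
      _ ≤ 2 * N * Real.exp 20 := by
          gcongr
          exact Nat.floor_le (by linarith)
  calc ∑ n ∈ dyadicRange N, (pairCount z a n : ℝ)
      ≤ ∑ n ∈ dyadicRange N, ((windowDivisors z n).card : ℝ) + ∑ n ∈ dyadicRange N,
          ∑ _d ∈ (roughDivisors z a n).filter (1 < ·), ((windowDivisors z n).card : ℝ) := by
        rw [← Finset.sum_add_distrib]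
        exact Finset.sum_le_sum fun n _ => hsplit n
    _ ≤ 338 * N * Real.exp 20 := by linarith [sum_roughDivisors_one_lt_le hz hN0 ha]
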